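/- **Setting.** Let $G=(P,Q,E)$ be a finite bipartite graph with $E\subseteq P\times Q$, $n=|P|+|Q|$, and let $\mu(G)$ denote its maximum matching size. The *block decomposition* of $G$ is obtained as follows. Start with $G_0=G$, $P^{(0)}=P$. As long as $P^{(i-1)}\neq\emptyset$, let $\alpha_i=\min_{\emptyset\ne S\subseteq P^{(i-1)}}|\Gamma_{G_{i-1}}(S)|/|S|$, let $P_i$ be the largest set $S$ attaining the minimum, let $Q_i=\Gamma_{G_{i-1}}(P_i)$, let $P^{(i)}=P^{(i-1)}\setminus P_i$, and let $G_i$ be $G_{i-1}$ with the vertices $P_i\cup Q_i$ removed. A *matching skeleton* of $G$ is a set $H=\bigcup_i\operatorname{supp}(x_i)$, where for every $i$ the function $x_i:(P_i\times Q_i)\cap E\to[0,1]$ has cycle-free support and satisfies $\sum_{q}x_i(p,q)=\alpha_i$ for all $p\in P_i$ and $\sum_p x_i(p,q)\le 1$ for all $q\in Q_i$. A *random $k$-partition* of $G$ sends each edge, independently and uniformly at random, to exactly one of $k$ subgraphs $G^{1},\dots,G^{k}$, all on the vertex set of $G$. **Theorem.** 1. Every finite bipartite graph $G$ has a matching skeleton.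 Every matching skeleton of $G$ is a subgraph of $G$ and a forest, and so (for $n\ge1$) has at most $n-1$ edges. 2. Matching skeletons are a $(1/2-o(1))$-approximate randomized composable coreset for bipartite maximum matching when $k=\omega(1)$ and $\mu(G)=\omega(k\log n)$. That is, for every $\varepsilon>0$ there are constants $k_0$ and $C$ such that for every finite bipartite graph $G$ on $n$ vertices and every $k\ge k_0$ with $\mu(G)\ge C\,k\log n$, if $G^{1},\dots,G^{k}$ is a random $k$-partition of $G$ and, for each outcome of the partition, $H_1,\dots,H_k$ are arbitrary matching skeletons of $G^1,\dots,G^k$ (the choice may depend on the whole outcome), then $$\mathbb E\bigl[\mu(H_1\cup\dots\cup H_k)\bigr]\;\ge\;\Bigl(\tfrac12-\varepsilon\Bigr)\,\mu(G).$$ -/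

import Mathlib

open Finset
open scoped BigOperators

universe u v

namespace BipartiteCoreset

/-- A bipartite graph with sides `P` and `Q` is given by its edge set `E ⊆ P × Q`.
This is the same graph as a simple graph on the vertex set `P ⊕ Q`. -/
def toGraph {P : Type u} {Q : Type v} (E : Set (P × Q)) : SimpleGraph (P ⊕ Q) where
  Adj a b := (∃ e ∈ E, a = Sum.inl e.1 ∧ b = Sum.inr e.2) ∨
    (∃ e ∈ E, b = Sum.inl e.1 ∧ a = Sum.inr e.2)
  symm := ⟨fun _ _ h => h.symm⟩
  loopless := ⟨by
    rintro a (⟨e, -, h₁, h₂⟩ | ⟨e, -, h₁, h₂⟩) <;> simp [h₁] at h₂⟩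

/-- A matching: a set of edges no two of which share an end point. -/
def IsMatching {P : Type u} {Q : Type v} (M : Finset (P × Q)) : Prop :=
  Set.InjOn Prod.fst (M : Set (P × Q)) ∧ Set.InjOn Prod.snd (M : Set (P × Q))

open Classical in
/-- The maximum size of a matching contained in the edge set `E`. -/
noncomputable def maxMatchingSize {P : Type u} {Q : Type v} (E : Finset (P × Q)) : ℕ :=
  (E.powerset.filter fun M => IsMatching M).sup Finset.card

/-- The neighbourhood `Γ(S) ⊆ Q` of a set `S ⊆ P` in the graph with edge set `E`. -/
def nbhd {P : Type u} {Q : Type v} [DecidableEq P] [DecidableEq Q]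
    (E : Finset (P × Q)) (S : Finset P) : Finset Q :=
  (E.filter fun e => e.1 ∈ S).image Prod.snd

/-- The expansion `|Γ(S)| / |S|` of a (nonempty) set `S ⊆ P`. -/
noncomputable def expansion {P : Type u} {Q : Type v} [DecidableEq P] [DecidableEq Q]
    (E : Finset (P × Q)) (S : Finset P) : ℝ :=
  (#(nbhd E S) : ℝ) / (#S : ℝ)

/-- The data `(Pᵢ, Qᵢ, αᵢ)` of a block. -/
structure Block (P : Type u) (Q : Type v) where
  left : Finset P
  right : Finset Q
  level : ℝ

/-- `B` is the block extracted from the graph with left vertex set `A` and edge set `E`: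
its level is the minimum expansion of a nonempty subset of `A`, its left part is a largest
nonempty subset of `A` attaining the minimum, its right part is the neighbourhood of the
left part. -/
structure IsFirstBlock {P : Type u} {Q : Type v} [DecidableEq P] [DecidableEq Q]
    (A : Finset P) (E : Finset (P × Q)) (B : Block P Q) : Prop where
  left_subset : B.left ⊆ A
  left_nonempty : B.left.Nonempty
  level_le : ∀ S ⊆ A, S.Nonempty → B.level ≤ expansion E S
  expansion_left : expansion E B.left = B.level
  card_le : ∀ S ⊆ A, S.Nonempty → expansion E S = B.level → #S ≤ #B.left
  right_eq : B.right = nbhd E B.left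

/-- The iteration: extract a block from the graph with left vertex set `A` and edge set `E`,
delete its vertices (together with all edges at them), and repeat until no vertex of the
left side is left. -/
inductive IsBlockSequence {P : Type u} {Q : Type v} [DecidableEq P] [DecidableEq Q] :
    Finset P → Finset (P × Q) → List (Block P Q) → Prop
  | nil (A : Finset P) (E : Finset (P × Q)) : A = ∅ → IsBlockSequence A E []
  | cons (A : Finset P) (E : Finset (P × Q)) (B : Block P Q) (l : List (Block P Q)) :
      IsFirstBlock A E B →
      IsBlockSequence (A \ B.left) (E.filter fun e => e.1 ∉ B.left ∧ e.2 ∉ B.right) l →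
      IsBlockSequence A E (B :: l)

/-- `l` is the block decomposition of the bipartite graph `(P, Q, E)`. -/
def IsBlockDecomposition {P : Type u} {Q : Type v} [Fintype P] [DecidableEq P] [DecidableEq Q]
    (E : Finset (P × Q)) (l : List (Block P Q)) : Prop :=
  IsBlockSequence Finset.univ E l

/-- `x` is an `α`-matching, with respect to the left side, of the graph with left vertex set
`A`, right vertex set `C` and edge set `(A × C) ∩ E` (with `x` extended by zero to all pairs):
every vertex of `A` is saturated exactly `α` times and every vertex of `C` at most once. -/
structure IsAlphaMatching {P : Type u} {Q : Type v}
    (E : Finset (P × Q)) (A : Finset P) (C : Finset Q) (α : ℝ) (x : P × Q → ℝ) : Prop where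
  nonneg : ∀ e, 0 ≤ x e
  le_one : ∀ e, x e ≤ 1
  support_subset : ∀ e, x e ≠ 0 → e ∈ E ∧ e.1 ∈ A ∧ e.2 ∈ C
  left_eq : ∀ p ∈ A, ∑ q ∈ C, x (p, q) = α
  right_le : ∀ q ∈ C, ∑ p ∈ A, x (p, q) ≤ 1

/-- `H` is a matching skeleton of the bipartite graph `(P, Q, E)`: the union, over the blocks
of the block decomposition, of the supports of cycle-free `α`-matchings of the blocks, where
`α` is the level of the block. (Distinct blocks have distinct left parts, so the `α`-matchings
can be indexed by the blocks themselves.) -/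
def IsMatchingSkeleton {P : Type u} {Q : Type v} [Fintype P] [DecidableEq P] [DecidableEq Q]
    (E H : Finset (P × Q)) : Prop :=
  ∃ (l : List (Block P Q)) (x : Block P Q → P × Q → ℝ),
    IsBlockDecomposition E l ∧
    (∀ B ∈ l, IsAlphaMatching E B.left B.right B.level (x B) ∧
      (toGraph (Function.support (x B))).IsAcyclic) ∧
    (H : Set (P × Q)) = ⋃ B ∈ l, Function.support (x B)

/-- The edge set of the `i`-th part of the `k`-partition of `E` in which each edge `e` is sent
to part `f e`. For `f` uniformly distributed over all functions `E → Fin k` (that is, every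
edge is sent to a uniformly random part, independently of the others), this is the random
`k`-partition. -/
def part {P : Type u} {Q : Type v} {k : ℕ}
    (E : Finset (P × Q)) (f : E → Fin k) (i : Fin k) : Finset (P × Q) :=
  (Finset.univ.filter fun e : E => f e = i).map (Function.Embedding.subtype _)

end BipartiteCoreset

open BipartiteCoreset

/-! The coreset bound rests on balanced assignments: each nonisolated right vertex spreads one unit
over its least loaded neighbours. The blocks have nondecreasing levels, so gluing their
`α`-matchings gives such an assignment supported in the skeleton
(`IsMatchingSkeleton.exists_isBalanced`). The loads depend only on the graph (`IsBalanced.load_eq`),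
so an edge that some balanced assignment leaves unused goes up: its right end is served at a load no
larger than that of its left end.

Let `M` be a maximum matching of size `μ`, and let König's theorem give a cover of the union of the
skeletons of size at most `h`, the matching size of that union. An uncovered edge of `M` is
superfluous for its own part. For each part, the uncovered edges of `M` superfluous for it number at
most `h / 2`: `IsBalanced.two_mul_card_le` charges `load + 1 / load ≥ 2` per edge to the cover.
Superfluity for a part is defined with the edge erased, so it ignores where the edge was sent.
Resampling that one edge then shows that an uncovered edge tends to be superfluous for many parts
(`sum_resample_nonneg`). Counting pairs of an edge and a part gives, in expectation, `h / 2 ≥ (μ -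
h) - μ / 4`, that is `h ≥ μ / 2`, with no error term.

For existence, Hall's theorem on a blow-up yields the `α`-matching of a block, and cancelling
circulations makes its support a forest. Distinct blocks share no vertices, so the union stays a
forest. -/

namespace BipartiteCoreset

/-! ### Balanced assignments and vertex covers -/

section

variable {P : Type u} {Q : Type v}

lemma card_le_maxMatchingSize {E M : Finset (P × Q)} (hM : IsMatching M) (h : M ⊆ E) :
    #M ≤ maxMatchingSize E := by
  classical
  exact Finset.le_sup (f := Finset.card) (by simp [h, hM])

lemma exists_isMatching_card_eq (E : Finset (P × Q)) :
    ∃ M ⊆ E, IsMatching M ∧ #M = maxMatchingSize E := by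
  classical
  obtain ⟨M, hM, h⟩ := Finset.exists_mem_eq_sup (E.powerset.filter fun M => IsMatching M)
    ⟨∅, by simp [IsMatching, Set.InjOn]⟩ Finset.card
  simp only [mem_filter, mem_powerset] at hM
  refine ⟨M, hM.1, hM.2, ?_⟩
  rw [maxMatchingSize]
  convert h.symm

variable [Fintype P] [Fintype Q]

/-- The total weight that `x` puts on the edges at a left vertex. -/
noncomputable def load (x : P × Q → ℝ) (p : P) : ℝ := ∑ q, x (p, q)

/-- A balanced assignment: every nonisolated right vertex distributes one unit of weight among
those of its neighbours whose load is smallest. -/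
structure IsBalanced (E : Finset (P × Q)) (x : P × Q → ℝ) : Prop where
  nonneg : ∀ e, 0 ≤ x e
  mem_of_ne : ∀ e, x e ≠ 0 → e ∈ E
  right_eq : ∀ e ∈ E, ∑ p, x (p, e.2) = 1
  load_le : ∀ p p' q, (p, q) ∈ E → x (p', q) ≠ 0 → load x p' ≤ load x p

namespace IsBalanced

variable {E : Finset (P × Q)} {x y : P × Q → ℝ}

lemma right_le (hx : IsBalanced E x) (q : Q) : ∑ p, x (p, q) ≤ 1 := by
  by_cases h : ∃ p, (p, q) ∈ E
  · obtain ⟨p, hp⟩ := h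
    exact (hx.right_eq _ hp).le
  · push Not at h
    rw [Finset.sum_eq_zero fun p _ => by_contra fun h0 => h p (hx.mem_of_ne _ h0)]
    exact zero_le_one

lemma exists_ne (hx : IsBalanced E x) {e : P × Q} (he : e ∈ E) : ∃ p, x (p, e.2) ≠ 0 := by
  by_contra! h
  have := hx.right_eq e he
  simp [h] at this

lemma load_pos (hx : IsBalanced E x) {p : P} {q : Q} (h : x (p, q) ≠ 0) : 0 < load x p :=
  (lt_of_le_of_ne (hx.nonneg _) h.symm).trans_le
    (Finset.single_le_sum (f := fun q => x (p, q)) (fun _ _ => hx.nonneg _) (mem_univ q))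

lemma load_nonneg (hx : IsBalanced E x) (p : P) : 0 ≤ load x p :=
  Finset.sum_nonneg fun _ _ => hx.nonneg _

/-- An assignment of the unit weight of `q` does not lower the average load. -/
lemma sum_mul_load_le (hx : IsBalanced E x) (hy : IsBalanced E y) (q : Q) :
    ∑ p, x (p, q) * load x p ≤ ∑ p, y (p, q) * load x p := by
  by_cases h : ∃ p, (p, q) ∈ E
  · obtain ⟨p, hp⟩ := h
    obtain ⟨r, hr⟩ := hx.exists_ne hp
    have h1 : ∑ p, x (p, q) * load x p ≤ ∑ p, x (p, q) * load x r := by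
      refine Finset.sum_le_sum fun s _ => ?_
      by_cases hs : x (s, q) = 0
      · simp [hs]
      · exact mul_le_mul_of_nonneg_left (hx.load_le _ _ _ (hx.mem_of_ne _ hr) hs) (hx.nonneg _)
    have h2 : ∑ p, y (p, q) * load x r ≤ ∑ p, y (p, q) * load x p := by
      refine Finset.sum_le_sum fun s _ => ?_
      by_cases hs : y (s, q) = 0
      · simp [hs]
      · exact mul_le_mul_of_nonneg_left (hx.load_le _ _ _ (hy.mem_of_ne _ hs) hr) (hy.nonneg _)
    rw [← Finset.sum_mul, hx.right_eq _ hp] at h1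
    rw [← Finset.sum_mul, hy.right_eq _ hp] at h2
    exact h1.trans h2
  · push Not at h
    rw [Finset.sum_eq_zero fun p _ => ?_, Finset.sum_eq_zero fun p _ => ?_]
    · rw [by_contra fun h0 => h p (hy.mem_of_ne _ h0), zero_mul]
    · rw [by_contra fun h0 => h p (hx.mem_of_ne _ h0), zero_mul]

/-- The loads of a balanced assignment are determined by the graph. -/
lemma load_eq (hx : IsBalanced E x) (hy : IsBalanced E y) (p : P) : load x p = load y p := by
  -- Each assignment minimises the total weighted by its own loads. Adding the two minimality
  -- inequalities leaves a sum of squares that is at most zero.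
  have key : ∑ p, (load x p - load y p) ^ 2 ≤ 0 := by
    have e : ∀ z w : P × Q → ℝ, ∑ p, load z p * load w p = ∑ q, ∑ p, z (p, q) * load w p := by
      intro z w
      rw [Finset.sum_comm]
      exact Finset.sum_congr rfl fun p _ => by rw [← Finset.sum_mul]; rfl
    have h1 := Finset.sum_le_sum fun q (_ : q ∈ univ) => hx.sum_mul_load_le hy q
    have h2 := Finset.sum_le_sum fun q (_ : q ∈ univ) => hy.sum_mul_load_le hx q
    rw [← e, ← e] at h1 h2
    have h3 : ∑ p, (load x p - load y p) ^ 2 = ∑ p, load x p * load x p -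
        ∑ p, load y p * load x p + (∑ p, load y p * load y p - ∑ p, load x p * load y p) := by
      rw [← Finset.sum_sub_distrib, ← Finset.sum_sub_distrib, ← Finset.sum_add_distrib]
      exact Finset.sum_congr rfl fun p _ => by ring
    linarith
  have h0 := (Finset.sum_eq_zero_iff_of_nonneg fun p _ => sq_nonneg (load x p - load y p)).1
    (le_antisymm key (Finset.sum_nonneg fun p _ => sq_nonneg _)) p (mem_univ p)
  linarith [pow_eq_zero_iff (two_ne_zero) |>.1 h0]

variable [DecidableEq P] [DecidableEq Q] in
lemma of_insert {e : P × Q} (hx : IsBalanced (insert e E) x) (he : x e = 0) : IsBalanced E x where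
  nonneg := hx.nonneg
  mem_of_ne e' h := by
    rcases Finset.mem_insert.1 (hx.mem_of_ne e' h) with rfl | h'
    · exact absurd he h
    · exact h'
  right_eq e' h := hx.right_eq e' (Finset.mem_insert_of_mem h)
  load_le p p' q h h' := hx.load_le p p' q (Finset.mem_insert_of_mem h) h'

end IsBalanced

variable [DecidableEq P] [DecidableEq Q]

/-- The edge `e` can be left out by a balanced assignment of the graph with `e` added. -/
def IsSuperfluous (E : Finset (P × Q)) (e : P × Q) : Prop :=
  ∃ x, IsBalanced (insert e E) x ∧ x e = 0

/-- If `e` is superfluous then, in any balanced assignment of the graph without `e`, the right end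
of `e` is served by a vertex whose load is at most that of its left end. -/
lemma IsSuperfluous.exists_load_le {E : Finset (P × Q)} {e : P × Q}
    (he : IsSuperfluous E e) {x : P × Q → ℝ} (hx : IsBalanced E x) :
    ∃ p, x (p, e.2) ≠ 0 ∧ load x p ≤ load x e.1 := by
  obtain ⟨y, hy, hye⟩ := he
  -- Omitting the unused edge keeps `y` balanced, so `x` and `y` have equal loads, while `y` still
  -- obeys the load condition along `e`.
  have hy' := hy.of_insert hye
  obtain ⟨p, hp⟩ := hy.exists_ne (Finset.mem_insert_self e E)
  have hpE := hy'.mem_of_ne _ hp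
  obtain ⟨r, hr⟩ := hx.exists_ne hpE
  refine ⟨r, hr, (hx.load_le _ _ _ hpE hr).trans ?_⟩
  rw [hx.load_eq hy', hx.load_eq hy']
  exact hy.load_le _ _ _ (Finset.mem_insert_self _ _) hp

/-- A cover of the support of a balanced assignment has at least twice as many vertices as any
matching that avoids it and whose edges go up with respect to the load. -/
lemma IsBalanced.two_mul_card_le {E : Finset (P × Q)} {x : P × Q → ℝ} (hx : IsBalanced E x)
    {A : Finset P} {B : Finset Q} (hcov : ∀ e, x e ≠ 0 → e.1 ∈ A ∨ e.2 ∈ B)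
    {U : Finset (P × Q)} (hU : IsMatching U) (hA : ∀ e ∈ U, e.1 ∉ A) (hB : ∀ e ∈ U, e.2 ∉ B)
    (hload : ∀ e ∈ U, ∃ p, x (p, e.2) ≠ 0 ∧ load x p ≤ load x e.1) :
    2 * #U ≤ #A + #B := by
  -- The left end of `e` is outside `A`, so all its load comes from `B`, and each vertex of `B`
  -- gives out at most one unit.
  have hleft : ∑ e ∈ U, load x e.1 ≤ #B := by
    calc ∑ e ∈ U, load x e.1 = ∑ e ∈ U, ∑ q ∈ B, x (e.1, q) := by
          refine Finset.sum_congr rfl fun e he => ?_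
          refine (Finset.sum_subset (subset_univ B) fun q _ hq => ?_).symm
          by_contra h
          exact (hcov _ h).elim (hA e he) hq
      _ = ∑ q ∈ B, ∑ p ∈ U.image Prod.fst, x (p, q) := by
          rw [Finset.sum_comm]
          exact Finset.sum_congr rfl fun q _ => 
            (Finset.sum_image (f := fun p => x (p, q)) hU.1).symm
      _ ≤ ∑ q ∈ B, (1 : ℝ) := by
          refine Finset.sum_le_sum fun q _ => le_trans ?_ (hx.right_le q)
          exact Finset.sum_le_sum_of_subset_of_nonneg (subset_univ _) fun p _ _ => hx.nonneg _
      _ = #B := by simp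
  -- Dually, the right end of `e` is served from `A` only. Normalised by the load, each vertex of
  -- `A` receives at most one in all.
  have hright : ∑ e ∈ U, ∑ p, x (p, e.2) / load x p ≤ #A := by
    calc ∑ e ∈ U, ∑ p, x (p, e.2) / load x p = ∑ e ∈ U, ∑ p ∈ A, x (p, e.2) / load x p := by
          refine Finset.sum_congr rfl fun e he => ?_
          refine (Finset.sum_subset (subset_univ A) fun p _ hp => ?_).symm
          rw [by_contra fun h => (hcov (p, e.2) h).elim hp (hB e he), zero_div]
      _ = ∑ p ∈ A, ∑ q ∈ U.image Prod.snd, x (p, q) / load x p := by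
          rw [Finset.sum_comm]
          exact Finset.sum_congr rfl fun p _ =>
            (Finset.sum_image (f := fun q => x (p, q) / load x p) hU.2).symm
      _ ≤ ∑ p ∈ A, (1 : ℝ) := by
          refine Finset.sum_le_sum fun p _ => ?_
          rw [← Finset.sum_div]
          refine div_le_one_of_le₀ ?_ (hx.load_nonneg p)
          exact Finset.sum_le_sum_of_subset_of_nonneg (subset_univ _) fun p _ _ => hx.nonneg _
      _ = #A := by simp
  have hU2 : ∑ e ∈ U, (2 : ℝ) ≤ ∑ e ∈ U, (load x e.1 + ∑ p, x (p, e.2) / load x p) := by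
    refine Finset.sum_le_sum fun e he => ?_
    obtain ⟨r, hr, hre⟩ := hload e he
    have hr0 := hx.load_pos hr
    -- All vertices serving the same right vertex have the same load.
    have : ∑ p, x (p, e.2) / load x p = 1 / load x r := by
      rw [← hx.right_eq _ (hx.mem_of_ne _ hr), Finset.sum_div]
      refine Finset.sum_congr rfl fun p _ => ?_
      by_cases hp : x (p, e.2) = 0
      · simp [hp]
      · rw [le_antisymm (hx.load_le _ _ _ (hx.mem_of_ne _ hr) hp)
          (hx.load_le _ _ _ (hx.mem_of_ne _ hp) hr)]
    rw [this]
    have h2 : 2 ≤ load x r + 1 / load x r := by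
      have : load x r + 1 / load x r - 2 = (load x r - 1) ^ 2 / load x r := by
        field_simp
        ring
      have := div_nonneg (sq_nonneg (load x r - 1)) hr0.le
      linarith
    linarith
  rw [Finset.sum_add_distrib, Finset.sum_const, nsmul_eq_mul] at hU2
  have : (2 * #U : ℝ) ≤ #A + #B := by linarith
  exact_mod_cast this

/-- König's theorem: there is a vertex cover that is no larger than a maximum matching. -/
lemma exists_cover (E : Finset (P × Q)) :
    ∃ (A : Finset P) (B : Finset Q), (∀ e ∈ E, e.1 ∈ A ∨ e.2 ∈ B) ∧
      #A + #B ≤ maxMatchingSize E := by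
  -- Let `S` have the largest deficiency `d`. With `d` dummy right vertices joined to every left
  -- vertex, Hall's condition holds. At most `d` left vertices are matched to dummies, and the cover
  -- `(P \ S, Γ(S))` has size `|P| - d`.
  obtain ⟨S, -, hS⟩ := Finset.exists_max_image (univ : Finset (Finset P))
    (fun S => (#S : ℤ) - #(nbhd E S)) ⟨∅, mem_univ _⟩
  have h0 := hS ∅ (mem_univ _)
  have hempty : nbhd E (∅ : Finset P) = ∅ := by simp [nbhd]
  rw [hempty] at h0
  simp only [card_empty, Nat.cast_zero, sub_zero] at h0
  obtain ⟨d, hd⟩ := Int.eq_ofNat_of_zero_le h0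
  let t : P → Finset (Q ⊕ Fin d) := fun p => (nbhd E {p}).disjSum univ
  have hall : ∀ T : Finset P, #T ≤ #(T.biUnion t) := by
    intro T
    rcases T.eq_empty_or_nonempty with rfl | ⟨p, hp⟩
    · simp
    have hT := hS T (mem_univ _)
    have hsub : (nbhd E T).disjSum univ ⊆ T.biUnion t := by
      intro a ha
      rw [mem_biUnion]
      rcases Finset.mem_disjSum.1 ha with ⟨q, hq, rfl⟩ | ⟨i, -, rfl⟩
      · simp only [nbhd, mem_image, mem_filter] at hq
        obtain ⟨e, ⟨he, heT⟩, rfl⟩ := hq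
        refine ⟨e.1, heT, ?_⟩
        simp only [t, inl_mem_disjSum, nbhd, mem_image, mem_filter, mem_singleton]
        exact ⟨e, ⟨he, rfl⟩, rfl⟩
      · exact ⟨p, hp, by simp [t]⟩
    have := card_le_card hsub
    rw [card_disjSum, card_univ, Fintype.card_fin] at this
    omega
  obtain ⟨φ, hφ, hφt⟩ := (Finset.all_card_le_biUnion_card_iff_exists_injective t).1 hall
  refine ⟨univ \ S, nbhd E S, fun e he => ?_, ?_⟩
  · by_cases h : e.1 ∈ S
    · exact Or.inr (mem_image_of_mem _ (by simp [he, h]))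
    · exact Or.inl (by simp [h])
  · let M : Finset (P × Q) := univ.filter fun e => φ e.1 = Sum.inl e.2
    have hME : M ⊆ E := by
      intro e he
      have h1 := hφt e.1
      simp only [M, mem_filter] at he
      rw [he.2] at h1
      simp only [t, inl_mem_disjSum, nbhd, mem_image, mem_filter, mem_singleton] at h1
      obtain ⟨e', ⟨h2, h3⟩, h4⟩ := h1
      rwa [Prod.ext h3 h4] at h2
    have hM : IsMatching M := by
      refine ⟨fun e he e' he' h => ?_, fun e he e' he' h => ?_⟩
      · simp only [M, coe_filter, mem_univ, true_and, Set.mem_ofPred_eq] at he he'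
        refine Prod.ext h ?_
        rw [h, he'] at he
        exact (Sum.inl_injective he).symm
      · simp only [M, coe_filter, mem_univ, true_and, Set.mem_ofPred_eq] at he he'
        refine Prod.ext (hφ ?_) h
        rw [he, he', h]
    have hcard : Fintype.card P ≤ #M + d := by
      have hsub : (univ : Finset P).image φ ⊆ (M.image Prod.snd).disjSum univ := by
        intro a ha
        obtain ⟨p, -, rfl⟩ := mem_image.1 ha
        rcases h : φ p with q | i
        · rw [inl_mem_disjSum, mem_image]
          exact ⟨(p, q), by simp [M, h], rfl⟩
        · simp
      have := card_le_card hsub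
      rw [card_image_of_injective _ hφ, card_disjSum, card_univ, card_univ, Fintype.card_fin,
        card_image_of_injOn hM.2] at this
      exact this
    have h1 := card_le_maxMatchingSize hM hME
    have h2 : #(univ \ S) = Fintype.card P - #S := by
      rw [card_sdiff_of_subset (subset_univ S), card_univ]
    have h3 : #S ≤ Fintype.card P := card_le_univ S
    omega

end

/-! ### Resampling an edge, and the bound of one half -/

section

lemma mem_part {P : Type u} {Q : Type v} {k : ℕ} {E : Finset (P × Q)} {f : E → Fin k} {i : Fin k}
    {e : P × Q} : e ∈ part E f i ↔ ∃ h : e ∈ E, f ⟨e, h⟩ = i := by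
  simp [part]

lemma erase_part_update {P : Type u} {Q : Type v} [DecidableEq P] [DecidableEq Q] {k : ℕ}
    (E : Finset (P × Q)) (f : E → Fin k) (e : E) (i j : Fin k) :
    (part E (Function.update f e i) j).erase e = (part E f j).erase e := by
  ext e'
  simp only [mem_erase, mem_part, ne_eq, and_congr_right_iff]
  intro h
  refine exists_congr fun h' => ?_
  rw [Function.update_of_ne]
  exact fun h2 => h (congrArg Subtype.val h2)

/-- Resampling one coordinate does not change the sum over all functions. -/
lemma sum_sum_update {ι κ : Type*} [Fintype ι] [DecidableEq ι] [Fintype κ]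
    (φ : (ι → κ) → ℝ) (e : ι) :
    ∑ f, ∑ i, φ (Function.update f e i) = Fintype.card κ * ∑ f, φ f := by
  -- Swapping the coordinate `e` of the function with the spare value is an involution.
  have h : ∑ a : (ι → κ) × κ, φ (Function.update a.1 e a.2) = ∑ a : (ι → κ) × κ, φ a.1 :=
    Finset.sum_nbij' (fun a => (Function.update a.1 e a.2, a.1 e))
      (fun a => (Function.update a.1 e a.2, a.1 e)) (fun _ _ => mem_univ _)
      (fun _ _ => mem_univ _) (fun a _ => by simp) (fun a _ => by simp) (fun _ _ => rfl)
  rw [Fintype.sum_prod_type, Fintype.sum_prod_type] at h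
  refine h.trans ?_
  rw [mul_sum]
  exact Finset.sum_congr rfl fun f _ => by simp

/-- Suppose an event `u` forces the coordinate `e` of `f` to lie in a set of `b` values that does
not depend on this coordinate. Then `b` is correlated with `u`. -/
lemma sum_resample_nonneg {ι : Type*} [Fintype ι] [DecidableEq ι] {k : ℕ} (hk : 0 < k) (e : ι)
    (u : (ι → Fin k) → ℝ) (bad : (ι → Fin k) → Fin k → ℝ) (hu : ∀ f, 0 ≤ u f)
    (hbad : ∀ f i j, bad (Function.update f e i) j = bad f j)
    (h : ∀ f, u f ≤ bad f (f e)) :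
    0 ≤ ∑ f, (u f * ∑ j, bad f j - k * u f + k / 4) := by
  have h1 := sum_sum_update (fun f => u f * ∑ j, bad f j - k * u f + (k : ℝ) / 4) e
  have h2 : 0 ≤ ∑ f, ∑ i, (u (Function.update f e i) * ∑ j, bad (Function.update f e i) j
      - k * u (Function.update f e i) + (k : ℝ) / 4) := by
    refine sum_nonneg fun f _ => ?_
    simp_rw [hbad]
    rw [sum_add_distrib, sum_sub_distrib, ← sum_mul, ← mul_sum]
    simp only [sum_const, card_univ, Fintype.card_fin, nsmul_eq_mul]
    have hg0 : 0 ≤ ∑ i, u (Function.update f e i) := sum_nonneg fun i _ => hu _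
    have hgb : ∑ i, u (Function.update f e i) ≤ ∑ i, bad f i := by
      refine sum_le_sum fun i _ => (h _).trans ?_
      rw [hbad, Function.update_self]
    -- With `g` and `b` the sums of `u` and `bad` over the `k` resamplings, `g ≤ b` gives `g b - k g
    -- + k² / 4 ≥ (g - k / 2)² ≥ 0`; this is where the constant `k / 4` comes from.
    nlinarith [mul_le_mul_of_nonneg_left hgb hg0,
      sq_nonneg (∑ i, u (Function.update f e i) - (k : ℝ) / 2)]
  rw [h1, Fintype.card_fin] at h2
  exact nonneg_of_mul_nonneg_right h2 (by exact_mod_cast hk)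

variable {P : Type u} {Q : Type v} [Fintype P] [Fintype Q] [DecidableEq P] [DecidableEq Q]

/-- If each part of a random `k`-partition sends the support of a balanced assignment, then the
union contains in expectation a matching of at least half the maximum size. -/
lemma half_le_expect_of_isBalanced (E : Finset (P × Q)) {k : ℕ} (hk : 0 < k)
    (H : (E → Fin k) → Fin k → Finset (P × Q))
    (hH : ∀ f i, ∃ x, IsBalanced (part E f i) x ∧ ∀ e, x e ≠ 0 → e ∈ H f i) :
    (maxMatchingSize E : ℝ) / 2 ≤ Finset.expect Finset.univ fun f : E → Fin k =>
      (maxMatchingSize (Finset.univ.biUnion (H f)) : ℝ) := by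
  classical
  obtain ⟨M, hME, hM, hMcard⟩ := exists_isMatching_card_eq E
  choose x hx hxH using hH
  choose A B hcov hAB using fun f => exists_cover (Finset.univ.biUnion (H f))
  have hcov' : ∀ f i e, x f i e ≠ 0 → e.1 ∈ A f ∨ e.2 ∈ B f := fun f i e he =>
    hcov f e (mem_biUnion.2 ⟨i, mem_univ _, hxH f i e he⟩)
  let μ : ℝ := maxMatchingSize E
  let h : (E → Fin k) → ℝ := fun f => maxMatchingSize (Finset.univ.biUnion (H f))
  let u : (E → Fin k) → E → ℝ := fun f e => if e.1.1 ∉ A f ∧ e.1.2 ∉ B f then 1 else 0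
  let bad : E → (E → Fin k) → Fin k → ℝ := fun e f j =>
    if IsSuperfluous ((part E f j).erase e) e then 1 else 0
  let M' : Finset E := M.subtype (· ∈ E)
  have hM' : (#M' : ℝ) = μ := by
    have : #M' = #M := by
      rw [card_subtype, filter_true_of_mem hME]
    rw [this, hMcard]
  have key : ∀ e : E, 0 ≤ ∑ f, (u f e * ∑ j, bad e f j - k * u f e + k / 4) := by
    intro e
    refine sum_resample_nonneg hk e (fun f => u f e) (bad e) (fun f => ?_) (fun f i j => ?_)
      fun f => ?_
    · simp only [u]; split_ifs <;> norm_num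
    · simp only [bad, erase_part_update]
    · by_cases hu : e.1.1 ∉ A f ∧ e.1.2 ∉ B f
      · have : IsSuperfluous ((part E f (f e)).erase e) e := by
          refine ⟨x f (f e), ?_, by_contra fun h0 => ?_⟩
          · rw [insert_erase (mem_part.2 ⟨e.2, rfl⟩)]
            exact hx f (f e)
          · exact (hcov' f _ _ h0).elim hu.1 hu.2
        simp [u, bad, hu, this]
      · simp only [u, bad, if_neg hu]; split_ifs <;> norm_num
  have hbad : ∀ f, 2 * ∑ e ∈ M', u f e * ∑ j, bad e f j ≤ k * h f := by
    intro f
    have hj : ∀ j, 2 * ∑ e ∈ M', u f e * bad e f j ≤ h f := by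
      intro j
      let U : Finset E := M'.filter fun e =>
        (e.1.1 ∉ A f ∧ e.1.2 ∉ B f) ∧ IsSuperfluous ((part E f j).erase e) e
      have hU : ∑ e ∈ M', u f e * bad e f j = #(U.map (Function.Embedding.subtype _)) := by
        rw [card_map, card_filter]
        push_cast
        refine sum_congr rfl fun e _ => ?_
        simp only [u, bad, ite_and]
        split_ifs <;> simp
      rw [hU]
      have hUM : ∀ e ∈ U.map (Function.Embedding.subtype _), e ∈ M ∧
          (e.1 ∉ A f ∧ e.2 ∉ B f) ∧ IsSuperfluous ((part E f j).erase e) e := by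
        intro e he
        obtain ⟨e', he', rfl⟩ := mem_map.1 he
        simpa [U, M'] using he'
      have := (hx f j).two_mul_card_le (hcov' f j) (U := U.map (Function.Embedding.subtype _))
        ⟨hM.1.mono fun e he => (hUM e he).1, hM.2.mono fun e he => (hUM e he).1⟩
        (fun e he => (hUM e he).2.1.1) (fun e he => (hUM e he).2.1.2) fun e he => ?_
      · simp only [h]
        exact_mod_cast this.trans (hAB f)
      · obtain ⟨-, hc, hs⟩ := hUM e he
        -- If `e` lies in part `j`, the load condition applies to `e` directly; otherwise
        -- superfluity is needed.
        by_cases hej : e ∈ part E f j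
        · obtain ⟨p, hp⟩ := (hx f j).exists_ne hej
          exact ⟨p, hp, (hx f j).load_le _ _ _ hej hp⟩
        · rw [erase_eq_of_notMem hej] at hs
          exact hs.exists_load_le (hx f j)
    calc 2 * ∑ e ∈ M', u f e * ∑ j, bad e f j = ∑ j, 2 * ∑ e ∈ M', u f e * bad e f j := by
          rw [← mul_sum, sum_comm]
          simp_rw [mul_sum]
      _ ≤ ∑ j : Fin k, h f := sum_le_sum fun j _ => hj j
      _ = k * h f := by simp
  -- Each vertex of the cover meets at most one edge of `M`.
  have hunc : ∀ f, μ - h f ≤ ∑ e ∈ M', u f e := by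
    intro f
    have h1 : M ⊆ M.filter (fun e => e.1 ∈ A f) ∪ (M.filter (fun e => e.2 ∈ B f) ∪
        (M'.filter fun e => e.1.1 ∉ A f ∧ e.1.2 ∉ B f).map (Function.Embedding.subtype _)) := by
      intro e he
      by_cases h1 : e.1 ∈ A f
      · simp [he, h1]
      · by_cases h2 : e.2 ∈ B f
        · simp [he, h2]
        · simp [he, h1, h2, M', hME he]
    have h2 : #(M.filter (fun e => e.1 ∈ A f)) ≤ #(A f) :=
      card_le_card_of_injOn Prod.fst (fun e he => (mem_filter.1 he).2)
        (hM.1.mono fun e he => (mem_filter.1 he).1)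
    have h3 : #(M.filter (fun e => e.2 ∈ B f)) ≤ #(B f) :=
      card_le_card_of_injOn Prod.snd (fun e he => (mem_filter.1 he).2)
        (hM.2.mono fun e he => (mem_filter.1 he).1)
    have h4 := card_le_card h1
    have h5 := card_union_le (M.filter (fun e => e.1 ∈ A f)) (M.filter (fun e => e.2 ∈ B f) ∪
        (M'.filter fun e => e.1.1 ∉ A f ∧ e.1.2 ∉ B f).map (Function.Embedding.subtype _))
    have h6 := card_union_le (M.filter (fun e => e.2 ∈ B f))
        ((M'.filter fun e => e.1.1 ∉ A f ∧ e.1.2 ∉ B f).map (Function.Embedding.subtype _))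
    rw [card_map] at h6
    have h7 := hAB f
    have h8 : ∑ e ∈ M', u f e = #(M'.filter fun e => e.1.1 ∉ A f ∧ e.1.2 ∉ B f) := by
      simp [u]
    rw [h8, sub_le_iff_le_add]
    simp only [μ, h]
    rw [← hMcard]
    norm_cast
    omega
  -- The summand is `k h / 2 - k (μ - h) + k μ / 4`, from `hbad`, `hunc` and the resampling constant
  -- over the `μ` edges of `M`.
  have hsum : 0 ≤ ∑ f, (k * (3 / 2 * h f - 3 / 4 * μ)) := by
    have h1 := sum_nonneg fun e (_ : e ∈ M') => key e
    rw [sum_comm] at h1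
    refine h1.trans (sum_le_sum fun f _ => ?_)
    rw [sum_add_distrib, sum_sub_distrib, ← mul_sum, sum_const, nsmul_eq_mul, hM']
    have hk' : (0 : ℝ) ≤ k := k.cast_nonneg
    nlinarith [hbad f, mul_le_mul_of_nonneg_left (hunc f) hk']
  rw [← mul_sum] at hsum
  have hsum' := nonneg_of_mul_nonneg_right hsum (by exact_mod_cast hk)
  rw [sum_sub_distrib, ← mul_sum, sum_const, nsmul_eq_mul] at hsum'
  have : Nonempty (E → Fin k) := ⟨fun _ => ⟨0, hk⟩⟩
  rw [Finset.expect_eq_sum_div_card, le_div_iff₀ (by exact_mod_cast card_pos.2 univ_nonempty)]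
  simp only [h, μ] at hsum'
  linarith

end

/-! ### From the block decomposition to a balanced assignment -/

section

section AlphaMatching

variable {P : Type u} {Q : Type v} {E : Finset (P × Q)} {A : Finset P} {C : Finset Q} {α : ℝ}
  {x : P × Q → ℝ}

lemma IsAlphaMatching.eq_zero_of_notMem_left (hx : IsAlphaMatching E A C α x) {p : P}
    (hp : p ∉ A) (q : Q) : x (p, q) = 0 :=
  by_contra fun h => hp (hx.support_subset _ h).2.1

lemma IsAlphaMatching.eq_zero_of_notMem_right (hx : IsAlphaMatching E A C α x) (p : P) {q : Q}
    (hq : q ∉ C) : x (p, q) = 0 :=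
  by_contra fun h => hq (hx.support_subset _ h).2.2

lemma IsAlphaMatching.load_eq [Fintype Q] (hx : IsAlphaMatching E A C α x) {p : P} (hp : p ∈ A) :
    load x p = α := by
  rw [← hx.left_eq p hp]
  exact (Finset.sum_subset (subset_univ C) fun q _ hq =>
    by_contra fun h => hq (hx.support_subset _ h).2.2).symm

/-- If the total weight equals the number of right vertices, all of these are saturated. -/
lemma IsAlphaMatching.right_eq [Fintype P] (hx : IsAlphaMatching E A C α x) (h : α * #A = #C) {q : Q}
    (hq : q ∈ C) : ∑ p, x (p, q) = 1 := by
  have h1 : ∀ q, ∑ p, x (p, q) = ∑ p ∈ A, x (p, q) := fun q =>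
    (Finset.sum_subset (subset_univ A) fun p _ hp => hx.eq_zero_of_notMem_left hp q).symm
  rw [h1]
  have h2 : ∑ q ∈ C, ∑ p ∈ A, x (p, q) = ∑ q ∈ C, 1 := by
    rw [Finset.sum_comm, Finset.sum_congr rfl hx.left_eq]
    simp only [sum_const, nsmul_eq_mul, mul_one]
    linarith
  exact (Finset.sum_eq_sum_iff_of_le hx.right_le).1 h2 q hq

end AlphaMatching

variable {P : Type u} {Q : Type v} [DecidableEq P] [DecidableEq Q]

lemma mem_nbhd {E : Finset (P × Q)} {S : Finset P} {q : Q} :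
    q ∈ nbhd E S ↔ ∃ p ∈ S, (p, q) ∈ E := by
  simp only [nbhd, mem_image, mem_filter, Prod.exists]
  constructor
  · rintro ⟨p, q', ⟨h1, h2⟩, rfl⟩
    exact ⟨p, h2, h1⟩
  · rintro ⟨p, h2, h1⟩
    exact ⟨p, q, ⟨h1, h2⟩, rfl⟩

lemma IsFirstBlock.level_mul_card {A : Finset P} {E : Finset (P × Q)} {B : Block P Q}
    (h : IsFirstBlock A E B) : B.level * #B.left = #B.right := by
  have h0 : (#B.left : ℝ) ≠ 0 := by exact_mod_cast h.left_nonempty.card_pos.ne'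
  rw [← h.expansion_left, h.right_eq, expansion, div_mul_cancel₀ _ h0]

lemma IsFirstBlock.level_mul_le {A : Finset P} {E : Finset (P × Q)} {B : Block P Q}
    (h : IsFirstBlock A E B) {S : Finset P} (hS : S ⊆ A) : B.level * #S ≤ #(nbhd E S) := by
  rcases S.eq_empty_or_nonempty with rfl | hne
  · simp
  · have h0 : (0 : ℝ) < #S := by exact_mod_cast hne.card_pos
    exact (le_div_iff₀ h0).1 (h.level_le S hS hne)

/-- The expansion of the sets that remain after the extraction of the first block. -/
lemma IsFirstBlock.level_le_expansion_rest {A : Finset P} {E : Finset (P × Q)} {B : Block P Q}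
    (h : IsFirstBlock A E B) {S : Finset P} (hS : S ⊆ A \ B.left) (hne : S.Nonempty) :
    B.level ≤ expansion (E.filter fun e => e.1 ∉ B.left ∧ e.2 ∉ B.right) S := by
  have h0 : (0 : ℝ) < #S := by exact_mod_cast hne.card_pos
  rw [expansion, le_div_iff₀ h0]
  have hdisj : Disjoint S B.left := disjoint_of_subset_left hS sdiff_disjoint
  -- A remaining set of smaller expansion would, joined to the first block, beat the minimum.
  have h1 := h.level_mul_le (S := S ∪ B.left)
    (union_subset (hS.trans sdiff_subset) h.left_subset)
  have h2 : nbhd E (S ∪ B.left) ⊆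
      nbhd (E.filter fun e => e.1 ∉ B.left ∧ e.2 ∉ B.right) S ∪ B.right := by
    intro q hq
    by_cases hqB : q ∈ B.right
    · exact mem_union_right _ hqB
    · obtain ⟨p, hp, hpq⟩ := mem_nbhd.1 hq
      have hpB : p ∉ B.left := fun hp' => hqB (h.right_eq ▸ mem_nbhd.2 ⟨p, hp', hpq⟩)
      refine mem_union_left _ (mem_nbhd.2 ⟨p, (mem_union.1 hp).resolve_right hpB, ?_⟩)
      simp [hpq, hpB, hqB]
  have h3 := (card_le_card h2).trans (card_union_le _ _)
  rw [card_union_of_disjoint hdisj] at h1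
  push_cast at h1
  have h4 : (#(nbhd E (S ∪ B.left)) : ℝ) ≤
      #(nbhd (E.filter fun e => e.1 ∉ B.left ∧ e.2 ∉ B.right) S) + #B.right := by
    exact_mod_cast h3
  linarith [h.level_mul_card]

lemma IsBlockSequence.left_subset {A : Finset P} {E : Finset (P × Q)} {l : List (Block P Q)}
    (h : IsBlockSequence A E l) : ∀ B ∈ l, B.left ⊆ A := by
  induction h with
  | nil => simp
  | cons A E B l hB _ ih =>
    intro C hC
    rcases List.mem_cons.1 hC with rfl | hC
    · exact hB.left_subset
    · exact (ih C hC).trans sdiff_subset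

lemma IsBlockSequence.exists_edge {A : Finset P} {E : Finset (P × Q)} {l : List (Block P Q)}
    (h : IsBlockSequence A E l) : ∀ B ∈ l, ∀ q ∈ B.right, ∃ p ∈ B.left, (p, q) ∈ E := by
  induction h with
  | nil => simp
  | cons A E B l hB _ ih =>
    intro C hC q hq
    rcases List.mem_cons.1 hC with rfl | hC
    · rw [hB.right_eq] at hq
      exact mem_nbhd.1 hq
    · obtain ⟨p, hp, hpq⟩ := ih C hC q hq
      exact ⟨p, hp, (mem_filter.1 hpq).1⟩

/-- The blocks after the first one are disjoint from it. -/
lemma IsBlockSequence.tail_disjoint {A : Finset P} {E : Finset (P × Q)} {B : Block P Q}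
    {l : List (Block P Q)}
    (h : IsBlockSequence (A \ B.left) (E.filter fun e => e.1 ∉ B.left ∧ e.2 ∉ B.right) l)
    {C : Block P Q} (hC : C ∈ l) : Disjoint C.left B.left ∧ Disjoint C.right B.right := by
  constructor
  · exact disjoint_of_subset_left (h.left_subset C hC) sdiff_disjoint
  · refine Finset.disjoint_left.2 fun q hq hqB => ?_
    obtain ⟨p, -, hp⟩ := h.exists_edge C hC q hq
    exact (mem_filter.1 hp).2.2 hqB

lemma IsBlockSequence.eq_of_mem_left {A : Finset P} {E : Finset (P × Q)} {l : List (Block P Q)}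
    (h : IsBlockSequence A E l) : ∀ B ∈ l, ∀ C ∈ l, ∀ p, p ∈ B.left → p ∈ C.left → B = C := by
  induction h with
  | nil => simp
  | cons A E B₀ l _ hl ih =>
    intro B hB C hC p hpB hpC
    rcases List.mem_cons.1 hB with rfl | hB' <;> rcases List.mem_cons.1 hC with rfl | hC'
    · rfl
    · exact absurd hpB (Finset.disjoint_left.1 (hl.tail_disjoint hC').1 hpC)
    · exact absurd hpC (Finset.disjoint_left.1 (hl.tail_disjoint hB').1 hpB)
    · exact ih B hB' C hC' p hpB hpC

lemma IsBlockSequence.eq_of_mem_right {A : Finset P} {E : Finset (P × Q)}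
    {l : List (Block P Q)} (h : IsBlockSequence A E l) :
    ∀ B ∈ l, ∀ C ∈ l, ∀ q, q ∈ B.right → q ∈ C.right → B = C := by
  induction h with
  | nil => simp
  | cons A E B₀ l _ hl ih =>
    intro B hB C hC q hqB hqC
    rcases List.mem_cons.1 hB with rfl | hB' <;> rcases List.mem_cons.1 hC with rfl | hC'
    · rfl
    · exact absurd hqB (Finset.disjoint_left.1 (hl.tail_disjoint hC').2 hqC)
    · exact absurd hqC (Finset.disjoint_left.1 (hl.tail_disjoint hB').2 hqB)
    · exact ih B hB' C hC' q hqB hqC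

variable [Fintype P] [Fintype Q]

/-- The union of `α`-matchings of the blocks is a balanced assignment. -/
lemma IsBlockSequence.exists_isBalanced {A : Finset P} {E : Finset (P × Q)}
    {l : List (Block P Q)} (h : IsBlockSequence A E l) (hE : ∀ e ∈ E, e.1 ∈ A)
    {x : Block P Q → P × Q → ℝ}
    (hx : ∀ B ∈ l, IsAlphaMatching E B.left B.right B.level (x B)) :
    ∃ z, IsBalanced E z ∧ (∀ e, z e ≠ 0 → ∃ B ∈ l, x B e ≠ 0) ∧
      ∀ a, (∀ S ⊆ A, S.Nonempty → a ≤ expansion E S) → ∀ p ∈ A, a ≤ load z p := by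
  induction h with
  | nil A E hA =>
    subst hA
    have hE' : E = ∅ := eq_empty_of_forall_notMem fun e he => by simpa using hE e he
    subst hE'
    exact ⟨0, ⟨by simp, by simp, by simp, by simp⟩, by simp, by simp⟩
  | cons A E B l hB hl ih =>
    have hxB := hx B (by simp)
    obtain ⟨z, hz, hzx, hza⟩ := ih
      (fun e he => by
        have := mem_filter.1 he
        exact mem_sdiff.2 ⟨hE e this.1, this.2.1⟩)
      (fun C hC => by
        have hC' := hx C (List.mem_cons_of_mem _ hC)
        have hd := hl.tail_disjoint hC
        refine ⟨hC'.nonneg, hC'.le_one, fun e he => ?_, hC'.left_eq, hC'.right_le⟩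
        have h3 := hC'.support_subset e he
        exact ⟨mem_filter.2 ⟨h3.1, Finset.disjoint_left.1 hd.1 h3.2.1,
          Finset.disjoint_left.1 hd.2 h3.2.2⟩, h3.2⟩)
    have hz0 : ∀ p q, p ∈ B.left ∨ q ∈ B.right → z (p, q) = 0 := by
      intro p q hpq
      by_contra h0
      have := (mem_filter.1 (hz.mem_of_ne _ h0)).2
      exact hpq.elim this.1 this.2
    have hload_mem : ∀ p ∈ B.left, load (fun e => x B e + z e) p = B.level := by
      intro p hp
      rw [← hxB.load_eq hp]
      exact Finset.sum_congr rfl fun q _ => by simp [hz0 p q (Or.inl hp)]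
    have hload_notMem : ∀ p ∉ B.left, load (fun e => x B e + z e) p = load z p := by
      intro p hp
      exact Finset.sum_congr rfl fun q _ => by simp [hxB.eq_zero_of_notMem_left hp]
    -- The lower bound on loads is carried through the induction for this: later vertices are loaded
    -- at least as much as the first block.
    have hlevel : ∀ p ∈ A \ B.left, B.level ≤ load z p :=
      hza _ fun S hS hne => hB.level_le_expansion_rest hS hne
    refine ⟨fun e => x B e + z e, ⟨fun e => add_nonneg (hxB.nonneg e) (hz.nonneg e),
      fun e he => ?_, fun e he => ?_, fun p p' q hpq hp' => ?_⟩, fun e he => ?_,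
      fun a ha p hp => ?_⟩
    · by_cases h0 : x B e = 0
      · rw [h0, zero_add] at he
        exact (mem_filter.1 (hz.mem_of_ne e he)).1
      · exact (hxB.support_subset e h0).1
    · rw [Finset.sum_add_distrib]
      by_cases hq : e.2 ∈ B.right
      · rw [hxB.right_eq hB.level_mul_card hq, Finset.sum_eq_zero fun p _ => hz0 p _ (Or.inr hq),
          add_zero]
      · rw [Finset.sum_eq_zero fun p _ => hxB.eq_zero_of_notMem_right p hq, zero_add]
        refine hz.right_eq e (mem_filter.2 ⟨he, fun hp => hq ?_, hq⟩)
        rw [hB.right_eq]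
        exact mem_nbhd.2 ⟨e.1, hp, he⟩
    -- A right vertex of the first block is served at the lowest level. Any other right vertex has
    -- no neighbour in `B.left`, so its load condition is inherited from `z`.
    · by_cases hq : q ∈ B.right
      · have hp'B : p' ∈ B.left := by
          by_contra h0
          exact hp' (by rw [hz0 p' q (Or.inr hq), hxB.eq_zero_of_notMem_left h0, add_zero])
        rw [hload_mem p' hp'B]
        by_cases hp : p ∈ B.left
        · rw [hload_mem p hp]
        · rw [hload_notMem p hp]
          exact hlevel p (mem_sdiff.2 ⟨hE _ hpq, hp⟩)
      · rw [hxB.eq_zero_of_notMem_right p' hq, zero_add] at hp'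
        have hpB : p ∉ B.left := fun hp => hq (hB.right_eq ▸ mem_nbhd.2 ⟨p, hp, hpq⟩)
        rw [hload_notMem p hpB, hload_notMem p' (mem_filter.1 (hz.mem_of_ne _ hp')).2.1]
        exact hz.load_le p p' q (mem_filter.2 ⟨hpq, hpB, hq⟩) hp'
    · by_cases h0 : x B e = 0
      · simp only [h0, zero_add] at he
        obtain ⟨C, hC, hCe⟩ := hzx e he
        exact ⟨C, List.mem_cons_of_mem _ hC, hCe⟩
      · exact ⟨B, by simp, h0⟩
    · have haB : a ≤ B.level := hB.expansion_left ▸ ha _ hB.left_subset hB.left_nonempty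
      by_cases hpB : p ∈ B.left
      · rwa [hload_mem p hpB]
      · rw [hload_notMem p hpB]
        exact haB.trans (hlevel p (mem_sdiff.2 ⟨hp, hpB⟩))

lemma IsMatchingSkeleton.exists_isBalanced {E H : Finset (P × Q)} (h : IsMatchingSkeleton E H) :
    ∃ x, IsBalanced E x ∧ ∀ e, x e ≠ 0 → e ∈ H := by
  obtain ⟨l, x, hl, hx, hH⟩ := h
  obtain ⟨z, hz, hzx, -⟩ := IsBlockSequence.exists_isBalanced hl (fun e _ => mem_univ e.1)
    fun B hB => (hx B hB).1
  refine ⟨z, hz, fun e he => ?_⟩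
  obtain ⟨B, hB, hBe⟩ := hzx e he
  rw [← mem_coe, hH]
  exact Set.mem_biUnion hB hBe

end

/-! ### Forests, flows and cycle cancelling -/

section

section Forest

variable {P : Type u} {Q : Type v}

lemma toGraph_adj_inl_inr {S : Set (P × Q)} {p : P} {q : Q} :
    (toGraph S).Adj (Sum.inl p) (Sum.inr q) ↔ (p, q) ∈ S := by
  simp [toGraph]

lemma toGraph_adj_cases {S : Set (P × Q)} {a b : P ⊕ Q} (h : (toGraph S).Adj a b) :
    ∃ p q, (p, q) ∈ S ∧ (a = Sum.inl p ∧ b = Sum.inr q ∨ a = Sum.inr q ∧ b = Sum.inl p) := by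
  rcases h with ⟨e, he, h1, h2⟩ | ⟨e, he, h1, h2⟩
  · exact ⟨e.1, e.2, he, Or.inl ⟨h1, h2⟩⟩
  · exact ⟨e.1, e.2, he, Or.inr ⟨h2, h1⟩⟩

/-- The vertex belongs to the block. -/
def Block.Mem (B : Block P Q) : P ⊕ Q → Prop :=
  Sum.elim (· ∈ B.left) (· ∈ B.right)

/-- A union of forests with disjoint vertex sets is a forest. -/
lemma isAcyclic_toGraph_iUnion {l : List (Block P Q)} {S : Block P Q → Set (P × Q)}
    (hS : ∀ B ∈ l, ∀ e ∈ S B, e.1 ∈ B.left ∧ e.2 ∈ B.right)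
    (hdisj : ∀ B ∈ l, ∀ C ∈ l, ∀ a : P ⊕ Q, B.Mem a → C.Mem a → B = C)
    (hacyc : ∀ B ∈ l, (toGraph (S B)).IsAcyclic) :
    (toGraph (⋃ B ∈ l, S B)).IsAcyclic := by
  have hadj : ∀ a b, (toGraph (⋃ B ∈ l, S B)).Adj a b →
      ∃ B ∈ l, B.Mem a ∧ B.Mem b ∧ (toGraph (S B)).Adj a b := by
    intro a b hab
    obtain ⟨p, q, hpq, h⟩ := toGraph_adj_cases hab
    obtain ⟨B, hB, he⟩ := Set.mem_iUnion₂.1 hpq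
    have hm := hS B hB _ he
    refine ⟨B, hB, ?_⟩
    rcases h with ⟨rfl, rfl⟩ | ⟨rfl, rfl⟩
    · exact ⟨hm.1, hm.2, toGraph_adj_inl_inr.2 he⟩
    · exact ⟨hm.2, hm.1, (toGraph_adj_inl_inr.2 he).symm⟩
  have hwalk : ∀ B ∈ l, ∀ {a b} (w : (toGraph (⋃ B ∈ l, S B)).Walk a b), B.Mem a →
      ∀ e ∈ w.edges, e ∈ (toGraph (S B)).edgeSet := by
    intro B hB a b w
    induction w with
    | nil => simp
    | cons h w ih =>
      intro ha e he
      obtain ⟨C, hC, hCa, hCb, hCadj⟩ := hadj _ _ h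
      obtain rfl := hdisj B hB C hC _ ha hCa
      rw [SimpleGraph.Walk.edges_cons, List.mem_cons] at he
      rcases he with rfl | he
      · exact hCadj
      · exact ih hCb e he
  intro a w hw
  cases w with
  | nil => exact hw.ne_nil rfl
  | cons h w =>
    obtain ⟨B, hB, hBa, -, -⟩ := hadj _ _ h
    exact hacyc B hB _ (hw.transfer (hwalk B hB _ hBa))

/-- A forest has fewer edges than vertices. -/
lemma card_add_one_le_of_isAcyclic [Fintype P] [Fintype Q] {H : Finset (P × Q)}
    (h : (toGraph (H : Set (P × Q))).IsAcyclic) (hn : 1 ≤ Fintype.card P + Fintype.card Q) :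
    #H + 1 ≤ Fintype.card P + Fintype.card Q := by
  classical
  rw [← Fintype.card_sum] at hn ⊢
  have : Nonempty (P ⊕ Q) := Fintype.card_pos_iff.1 hn
  -- The forest extends to a spanning tree of the complete graph, whose edge count is known.
  obtain ⟨F, hF, -, hFt⟩ :=
    (SimpleGraph.connected_top (V := P ⊕ Q)).exists_isTree_le_of_le_of_isAcyclic le_top h
  rw [← hFt.card_edgeFinset, add_le_add_iff_right]
  refine card_le_card_of_injOn (fun e => s(Sum.inl e.1, Sum.inr e.2)) (fun e he => ?_)
    fun e _ e' _ hee => ?_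
  · rw [mem_coe, SimpleGraph.mem_edgeFinset]
    exact hF (toGraph_adj_inl_inr.2 he)
  · simpa [Prod.ext_iff] using hee

variable [Fintype P] [Fintype Q]

open Classical in
omit [Fintype P] in
lemma sum_ite_eq_fst (p₀ p : P) (q₀ : Q) :
    ∑ q, (if (p, q) = (p₀, q₀) then 1 else 0 : ℝ) = if p₀ = p then 1 else 0 := by
  by_cases hp : p₀ = p
  · simp [hp]
  · simp [hp, Ne.symm hp]

open Classical in
omit [Fintype Q] in
lemma sum_ite_eq_snd (p₀ : P) (q₀ q : Q) :
    ∑ p, (if (p, q) = (p₀, q₀) then 1 else 0 : ℝ) = if q₀ = q then 1 else 0 := by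
  by_cases hq : q₀ = q
  · simp [hq]
  · simp [hq, Ne.symm hq]

open Classical in
/-- A walk carries a unit flow from its start to its end. Edges are oriented from left to
right. -/
lemma exists_flow {S : Set (P × Q)} {a b : P ⊕ Q} (w : (toGraph S).Walk a b) :
    ∃ d : P × Q → ℝ, (∀ e, d e ≠ 0 → e ∈ S) ∧
      (∀ p, ∑ q, d (p, q) = (if a = Sum.inl p then 1 else 0) - if b = Sum.inl p then 1 else 0) ∧
      ∀ q, ∑ p, d (p, q) = (if b = Sum.inr q then 1 else 0) - if a = Sum.inr q then 1 else 0 := by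
  induction w with
  | nil => exact ⟨0, by simp, by simp, by simp⟩
  | cons h w ih =>
    obtain ⟨d, hd, hP, hQ⟩ := ih
    obtain ⟨p₀, q₀, hS, ⟨rfl, rfl⟩ | ⟨rfl, rfl⟩⟩ := toGraph_adj_cases h
    · refine ⟨fun e => d e + if e = (p₀, q₀) then 1 else 0, fun e he => ?_, fun p => ?_,
        fun q => ?_⟩
      · by_cases h0 : e = (p₀, q₀)
        · exact h0 ▸ hS
        · exact hd e (by simpa [h0] using he)
      · rw [sum_add_distrib, hP, sum_ite_eq_fst]
        simp [sub_eq_add_neg, add_comm]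
      · rw [sum_add_distrib, hQ, sum_ite_eq_snd]
        simp [sub_eq_add_neg, add_comm]
    · refine ⟨fun e => d e - if e = (p₀, q₀) then 1 else 0, fun e he => ?_, fun p => ?_,
        fun q => ?_⟩
      · by_cases h0 : e = (p₀, q₀)
        · exact h0 ▸ hS
        · exact hd e (by simpa [h0] using he)
      · rw [sum_sub_distrib, hP, sum_ite_eq_fst]
        simp [sub_eq_add_neg, add_comm]
      · rw [sum_sub_distrib, hQ, sum_ite_eq_snd]
        simp [sub_eq_add_neg, add_comm]

/-- A graph that is not a forest carries a nonzero circulation. -/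
lemma exists_circulation {S : Set (P × Q)} (h : ¬ (toGraph S).IsAcyclic) :
    ∃ d : P × Q → ℝ, d ≠ 0 ∧ (∀ e, d e ≠ 0 → e ∈ S) ∧ (∀ p, ∑ q, d (p, q) = 0) ∧
      ∀ q, ∑ p, d (p, q) = 0 := by
  classical
  rw [SimpleGraph.isAcyclic_iff_forall_adj_isBridge] at h
  push Not at h
  obtain ⟨a, b, hab, hbr⟩ := h
  wlog hal : ∃ p, a = Sum.inl p generalizing a b
  · refine this b a hab.symm (by rwa [Sym2.eq_swap]) ?_
    obtain ⟨p, q, -, ⟨h, -⟩ | ⟨-, h⟩⟩ := toGraph_adj_cases hab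
    · exact (hal ⟨p, h⟩).elim
    · exact ⟨p, h⟩
  obtain ⟨p₀, rfl⟩ := hal
  obtain ⟨p, q₀, hS, ⟨hp, rfl⟩ | ⟨hp, -⟩⟩ := toGraph_adj_cases hab
  swap
  · cases hp
  obtain rfl := Sum.inl_injective hp
  rw [SimpleGraph.isBridge_iff, not_not] at hbr
  have hle : (toGraph S).deleteEdges {s(Sum.inl p₀, Sum.inr q₀)} ≤ toGraph (S \ {(p₀, q₀)}) := by
    intro a b h
    rw [SimpleGraph.deleteEdges_adj] at h
    obtain ⟨p, q, hpq, ⟨rfl, rfl⟩ | ⟨rfl, rfl⟩⟩ := toGraph_adj_cases h.1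
    · refine toGraph_adj_inl_inr.2 ⟨hpq, fun h0 => h.2 ?_⟩
      obtain ⟨rfl, rfl⟩ := Prod.mk.inj h0
      rfl
    · refine SimpleGraph.Adj.symm (toGraph_adj_inl_inr.2 ⟨hpq, fun h0 => h.2 ?_⟩)
      obtain ⟨rfl, rfl⟩ := Prod.mk.inj h0
      exact Sym2.eq_swap
  -- The edge is not a bridge, so a walk avoiding it joins its ends. The unit flow along the walk
  -- minus the edge is a circulation, nonzero because the flow vanishes on the edge.
  obtain ⟨w⟩ := hbr.mono hle
  obtain ⟨d, hd, hP, hQ⟩ := exists_flow w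
  refine ⟨fun e => d e - if e = (p₀, q₀) then 1 else 0, fun h0 => ?_, fun e he => ?_, fun p => ?_,
    fun q => ?_⟩
  · have h1 : d (p₀, q₀) = 0 := by_contra fun h1 => (hd _ h1).2 rfl
    have := congrFun h0 (p₀, q₀)
    simp [h1] at this
  · by_cases h0 : e = (p₀, q₀)
    · exact h0 ▸ hS
    · exact (hd e (by simpa [h0] using he)).1
  · rw [sum_sub_distrib, hP, sum_ite_eq_fst]
    simp [sub_eq_add_neg, add_comm]
  · rw [sum_sub_distrib, hQ, sum_ite_eq_snd]
    simp [sub_eq_add_neg, add_comm]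

open Classical in
/-- Cancelling cycles makes the support of an `α`-matching a forest. -/
lemma IsAlphaMatching.exists_isAcyclic {E : Finset (P × Q)} {A : Finset P} {C : Finset Q} {α : ℝ}
    {x : P × Q → ℝ} (hx : IsAlphaMatching E A C α x) :
    ∃ y, IsAlphaMatching E A C α y ∧ (toGraph (Function.support y)).IsAcyclic := by
  induction hn : #(univ.filter fun e => x e ≠ 0) using Nat.strong_induction_on generalizing x with
  | _ n ih =>
  by_cases hac : (toGraph (Function.support x)).IsAcyclic
  · exact ⟨x, hx, hac⟩
  obtain ⟨d, hd0, hd, hP, hQ⟩ := exists_circulation hac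
  -- A nonnegative function with zero sum at every left vertex vanishes.
  have hneg : ∃ e, d e < 0 := by
    by_contra! h
    refine hd0 (funext fun e => ?_)
    exact (sum_eq_zero_iff_of_nonneg fun q _ => h (e.1, q)).1 (hP e.1) e.2 (mem_univ _)
  obtain ⟨e₀, he₀, hmin⟩ := exists_min_image (univ.filter fun e => d e < 0)
    (fun e => x e / -d e) (by simpa [Finset.Nonempty] using hneg)
  simp only [mem_filter, mem_univ, true_and] at he₀ hmin
  -- The largest multiple of `d` that keeps all weights nonnegative; it brings `e₀` to zero, so the
  -- support shrinks.
  let t := x e₀ / -d e₀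
  have ht : 0 ≤ t := div_nonneg (hx.nonneg _) (by linarith)
  have hsupp : ∀ e, x e + t * d e ≠ 0 → x e ≠ 0 := by
    intro e he h0
    refine he ?_
    rw [h0, by_contra fun h1 : ¬ d e = 0 => hd e h1 h0, mul_zero, add_zero]
  have hy0 : ∀ e, 0 ≤ x e + t * d e := by
    intro e
    rcases le_or_gt 0 (d e) with h | h
    · exact add_nonneg (hx.nonneg e) (mul_nonneg ht h)
    · have h1 : t * -d e ≤ x e := (le_div_iff₀ (by linarith)).1 (hmin e h)
      linarith
  have hright : ∀ q ∈ C, ∑ p ∈ A, (x (p, q) + t * d (p, q)) ≤ 1 := by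
    intro q hq
    rw [sum_add_distrib, ← mul_sum, sum_subset (f := fun p => d (p, q)) (subset_univ A), hQ,
      mul_zero, add_zero]
    · exact hx.right_le q hq
    · exact fun p _ hp => by_contra fun h => hd _ h (hx.eq_zero_of_notMem_left hp q)
  have hy : IsAlphaMatching E A C α fun e => x e + t * d e := by
    refine ⟨hy0, fun e => ?_, fun e he => hx.support_subset e (hsupp e he), fun p hp => ?_, hright⟩
    · by_cases he : x e + t * d e = 0
      · exact he.le.trans zero_le_one
      · have h3 := hx.support_subset e (hsupp e he)
        exact (single_le_sum (f := fun p => x (p, e.2) + t * d (p, e.2)) (fun p _ => hy0 _)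
          h3.2.1).trans (hright e.2 h3.2.2)
    · rw [sum_add_distrib, ← mul_sum, sum_subset (f := fun q => d (p, q)) (subset_univ C), hP,
        mul_zero, add_zero]
      · exact hx.left_eq p hp
      · exact fun q _ hq => by_contra fun h => hd _ h (hx.eq_zero_of_notMem_right p hq)
  refine ih _ ?_ hy rfl
  rw [← hn]
  refine card_lt_card ((ssubset_iff_of_subset fun e => ?_).2 ⟨e₀, ?_, ?_⟩)
  · simpa using hsupp e
  · simpa using hd e₀ he₀.ne
  · simp only [ne_eq, mem_filter, mem_univ, true_and, not_not, t]
    field_simp [he₀.ne]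
    ring

end Forest

/-! ### Existence and structure of matching skeletons -/

variable {P : Type u} {Q : Type v} [DecidableEq P] [DecidableEq Q]

/-- Hall's theorem for the blow-up in which every left vertex of the block is replaced by as many
copies as the block has right vertices, and vice versa. -/
lemma IsFirstBlock.exists_isAlphaMatching {A : Finset P} {E : Finset (P × Q)} {B : Block P Q}
    (h : IsFirstBlock A E B) : ∃ x, IsAlphaMatching E B.left B.right B.level x := by
  have hm : (0 : ℝ) < #B.left := by exact_mod_cast h.left_nonempty.card_pos
  have hmem : ∀ q, q ∈ nbhd E B.left → q ∈ B.right := fun q hq => h.right_eq.symm ▸ hq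
  let t : B.left × Fin #B.right → Finset (Q × Fin #B.left) :=
    fun a => nbhd E {a.1.1} ×ˢ univ
  have hall : ∀ T : Finset (B.left × Fin #B.right), #T ≤ #(T.biUnion t) := by
    intro T
    let S : Finset P := T.image fun a => a.1.1
    have h1 : nbhd E S ×ˢ univ ⊆ T.biUnion t := by
      rintro ⟨q, i⟩ hq
      obtain ⟨p, hp, hpq⟩ := mem_nbhd.1 (mem_product.1 hq).1
      obtain ⟨a, ha, rfl⟩ := mem_image.1 hp
      exact mem_biUnion.2 ⟨a, ha, by simp [t, mem_nbhd, hpq]⟩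
    have h2 : #T ≤ #S * #B.right := by
      have : T.image (fun a => (a.1.1, a.2)) ⊆ S ×ˢ univ := by
        intro b hb
        obtain ⟨a, ha, rfl⟩ := mem_image.1 hb
        exact mem_product.2 ⟨mem_image_of_mem _ ha, mem_univ _⟩
      have h3 := card_le_card this
      rwa [card_image_of_injective, card_product, card_univ, Fintype.card_fin] at h3
      intro a b hab
      simp only [Prod.mk.injEq] at hab
      exact Prod.ext (Subtype.ext hab.1) hab.2
    -- Hall's condition is the minimality of the level `#B.right / #B.left`, cleared of
    -- denominators.
    have h3 : #S * #B.right ≤ #(nbhd E S) * #B.left := by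
      have hS : S ⊆ A := by
        intro p hp
        obtain ⟨a, -, rfl⟩ := mem_image.1 hp
        exact h.left_subset a.1.2
      have h4 := mul_le_mul_of_nonneg_right (h.level_mul_le hS) hm.le
      have h5 := h.level_mul_card
      have : (#S * #B.right : ℝ) ≤ #(nbhd E S) * #B.left := by
        rw [← h5]
        linarith
      exact_mod_cast this
    have h4 := card_le_card h1
    rw [card_product, card_univ, Fintype.card_fin] at h4
    exact h2.trans (h3.trans h4)
  obtain ⟨φ, hφ, hφt⟩ := (Finset.all_card_le_biUnion_card_iff_exists_injective t).1 hall
  let c : B.left → Q → Finset (Fin #B.right) := fun p q => univ.filter fun i => (φ (p, i)).1 = q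
  -- Each matched pair of copies carries weight `1 / #B.left`. The `#B.right` copies of a left
  -- vertex add up to the level, and the `#B.left` copies of a right vertex to at most one.
  let x : P × Q → ℝ := fun e => if hp : e.1 ∈ B.left then (#(c ⟨e.1, hp⟩ e.2) : ℝ) / #B.left else 0
  have hx0 : ∀ e, 0 ≤ x e := by
    intro e
    simp only [x]
    split_ifs <;> positivity
  have hsupp : ∀ e, x e ≠ 0 → e ∈ E ∧ e.1 ∈ B.left ∧ e.2 ∈ B.right := by
    intro e he
    have hp : e.1 ∈ B.left := by
      by_contra hp
      simp [x, hp] at he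
    have hc : #(c ⟨e.1, hp⟩ e.2) ≠ 0 := by
      intro h0
      simp [x, hp, h0] at he
    obtain ⟨i, hi⟩ := card_ne_zero.1 hc
    have h1 := hφt (⟨e.1, hp⟩, i)
    simp only [t, mem_product, mem_univ, and_true, (mem_filter.1 hi).2, mem_nbhd, mem_singleton,
      exists_eq_left] at h1
    exact ⟨h1, hp, hmem _ (mem_nbhd.2 ⟨e.1, hp, h1⟩)⟩
  have hright : ∀ q, ∑ p ∈ B.left, x (p, q) ≤ 1 := by
    intro q
    rw [← Finset.sum_coe_sort]
    have h1 : ∀ p : B.left, x (p, q) = (#(c p q) : ℝ) / #B.left := fun p => by simp [x]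
    simp_rw [h1]
    rw [← sum_div]
    refine div_le_one_of_le₀ ?_ hm.le
    have h2 : #((univ : Finset B.left).sigma fun p => c p q) ≤ #(univ : Finset (Fin #B.left)) := by
      refine card_le_card_of_injOn (fun a => (φ (a.1, a.2)).2) (fun _ _ => mem_univ _) ?_
      rintro ⟨p, i⟩ hp ⟨p', i'⟩ hp' heq
      simp only [c, coe_sigma, Set.mem_sigma_iff, mem_coe, mem_filter, mem_univ, true_and]
        at hp hp'
      have := hφ (Prod.ext (hp.trans hp'.symm) heq)
      simp only [Prod.mk.injEq] at this
      obtain ⟨rfl, rfl⟩ := this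
      rfl
    rw [card_sigma, card_univ, Fintype.card_fin] at h2
    exact_mod_cast h2
  refine ⟨x, hx0, fun e => ?_, hsupp, fun p hp => ?_, fun q _ => hright q⟩
  · by_cases he : x e = 0
    · exact he.le.trans zero_le_one
    · exact (single_le_sum (f := fun p => x (p, e.2)) (fun p _ => hx0 _)
        (hsupp e he).2.1).trans (hright e.2)
  · have h1 : ∀ q, x (p, q) = (#(c ⟨p, hp⟩ q) : ℝ) / #B.left := fun q => by simp [x, hp]
    simp_rw [h1]
    rw [← sum_div, div_eq_iff hm.ne', h.level_mul_card]
    have h2 : #(univ : Finset (Fin #B.right)) = ∑ q ∈ B.right, #(c ⟨p, hp⟩ q) := by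
      refine card_eq_sum_card_fiberwise fun i _ => ?_
      have h1 := hφt (⟨p, hp⟩, i)
      simp only [t, mem_product, mem_univ, and_true, mem_nbhd, mem_singleton,
        exists_eq_left] at h1
      exact hmem _ (mem_nbhd.2 ⟨p, hp, h1⟩)
    rw [card_univ, Fintype.card_fin] at h2
    exact_mod_cast h2.symm

lemma exists_isFirstBlock {A : Finset P} (hA : A.Nonempty) (E : Finset (P × Q)) :
    ∃ B, IsFirstBlock A E B := by
  obtain ⟨S₀, hS₀, hmin⟩ := exists_min_image (A.powerset.filter Finset.Nonempty) (expansion E)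
    ⟨A, by simp [hA]⟩
  obtain ⟨S, hS, hmax⟩ := exists_max_image
    ((A.powerset.filter Finset.Nonempty).filter fun S => expansion E S = expansion E S₀)
    Finset.card ⟨S₀, by simpa using hS₀⟩
  simp only [mem_filter, mem_powerset] at hS₀ hmin hS hmax
  exact ⟨⟨S, nbhd E S, expansion E S₀⟩, hS.1.1, hS.1.2, fun T hT hne => hmin T ⟨hT, hne⟩, hS.2,
    fun T hT hne hTe => hmax T ⟨⟨hT, hne⟩, hTe⟩, rfl⟩

lemma exists_isBlockSequence (A : Finset P) (E : Finset (P × Q)) :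
    ∃ l, IsBlockSequence A E l := by
  induction hn : #A using Nat.strong_induction_on generalizing A E with
  | _ n ih =>
  rcases A.eq_empty_or_nonempty with rfl | hA
  · exact ⟨[], .nil _ _ rfl⟩
  · obtain ⟨B, hB⟩ := exists_isFirstBlock hA E
    obtain ⟨l, hl⟩ := ih #(A \ B.left)
      (hn ▸ card_lt_card (sdiff_ssubset hB.left_subset hB.left_nonempty)) (A \ B.left)
      (E.filter fun e => e.1 ∉ B.left ∧ e.2 ∉ B.right) rfl
    exact ⟨B :: l, .cons _ _ _ _ hB hl⟩

lemma IsBlockSequence.exists_isAlphaMatching {A : Finset P} {E : Finset (P × Q)}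
    {l : List (Block P Q)} (h : IsBlockSequence A E l) :
    ∀ B ∈ l, ∃ x, IsAlphaMatching E B.left B.right B.level x := by
  induction h with
  | nil => simp
  | cons A E B l hB _ ih =>
    intro C hC
    rcases List.mem_cons.1 hC with rfl | hC
    · exact hB.exists_isAlphaMatching
    · obtain ⟨x, hx⟩ := ih C hC
      exact ⟨x, hx.nonneg, hx.le_one, fun e he => ⟨(mem_filter.1 (hx.support_subset e he).1).1,
        (hx.support_subset e he).2⟩, hx.left_eq, hx.right_le⟩

variable [Fintype P] [Fintype Q]

lemma exists_isMatchingSkeleton (E : Finset (P × Q)) : ∃ H, IsMatchingSkeleton E H := by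
  classical
  obtain ⟨l, hl⟩ := exists_isBlockSequence (univ : Finset P) E
  have h : ∀ B : Block P Q, ∃ x, B ∈ l → IsAlphaMatching E B.left B.right B.level x ∧
      (toGraph (Function.support x)).IsAcyclic := by
    intro B
    by_cases hB : B ∈ l
    · obtain ⟨x, hx⟩ := hl.exists_isAlphaMatching B hB
      obtain ⟨y, hy⟩ := hx.exists_isAcyclic
      exact ⟨y, fun _ => hy⟩
    · exact ⟨0, fun h => absurd h hB⟩
  choose x hx using h
  exact ⟨(Set.toFinite (⋃ B ∈ l, Function.support (x B))).toFinset, l, x, hl, hx, by simp⟩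

omit [Fintype Q] in
lemma IsMatchingSkeleton.subset {E H : Finset (P × Q)} (h : IsMatchingSkeleton E H) : H ⊆ E := by
  obtain ⟨l, x, -, hx, hH⟩ := h
  intro e he
  rw [← mem_coe, hH] at he
  obtain ⟨B, hB, heB⟩ := Set.mem_iUnion₂.1 he
  exact ((hx B hB).1.support_subset e heB).1

omit [Fintype Q] in
lemma IsMatchingSkeleton.isAcyclic {E H : Finset (P × Q)} (h : IsMatchingSkeleton E H) :
    (toGraph (H : Set (P × Q))).IsAcyclic := by
  obtain ⟨l, x, hl, hx, hH⟩ := h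
  rw [hH]
  refine isAcyclic_toGraph_iUnion (fun B hB e he => ((hx B hB).1.support_subset e he).2) ?_
    fun B hB => (hx B hB).2
  rintro B hB C hC (p | q)
  · exact IsBlockSequence.eq_of_mem_left hl B hB C hC p
  · exact IsBlockSequence.eq_of_mem_right hl B hB C hC q

end

end BipartiteCoreset

/-- First part: every finite bipartite graph has a matching skeleton, and each matching skeleton
is a subgraph which is a forest and has at most `n - 1` edges.

Second part: for families with `k = ω(1)` and `μ(G) = ω(k log n)`, the expected maximum matching
size of the union of arbitrary matching skeletons of the parts of a random `k`-partition is at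
least `(1/2 - o(1)) μ(G)`. The skeletons may be chosen adversarially, even depending on the whole
outcome `f` of the partition; `𝔼` is the average over all `f : E → Fin k`. -/
theorem theorem5p1 :
    (∀ (P : Type u) (Q : Type v) [Fintype P] [Fintype Q] [DecidableEq P] [DecidableEq Q]
        (E : Finset (P × Q)),
      (∃ H : Finset (P × Q), IsMatchingSkeleton E H) ∧
      ∀ H : Finset (P × Q), IsMatchingSkeleton E H →
        H ⊆ E ∧ (toGraph (H : Set (P × Q))).IsAcyclic ∧
        (1 ≤ Fintype.card P + Fintype.card Q →
          #H + 1 ≤ Fintype.card P + Fintype.card Q)) ∧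
    (∀ ε : ℝ, 0 < ε → ∃ (k₀ : ℕ) (C : ℝ),
      ∀ (P : Type u) (Q : Type v) [Fintype P] [Fintype Q] [DecidableEq P] [DecidableEq Q]
        (E : Finset (P × Q)) (k : ℕ),
        k₀ ≤ k →
        C * ((k : ℝ) * Real.log ((Fintype.card P + Fintype.card Q : ℕ) : ℝ))
          ≤ (maxMatchingSize E : ℝ) →
        ∀ H : (E → Fin k) → Fin k → Finset (P × Q),
          (∀ f i, IsMatchingSkeleton (part E f i) (H f i)) →
          (1 / 2 - ε) * (maxMatchingSize E : ℝ) ≤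
            Finset.expect Finset.univ fun f : E → Fin k =>
              (maxMatchingSize (Finset.univ.biUnion (H f)) : ℝ)) := by
  refine ⟨fun P Q _ _ _ _ E => ⟨exists_isMatchingSkeleton E, fun H hH =>
    ⟨hH.subset, hH.isAcyclic, card_add_one_le_of_isAcyclic hH.isAcyclic⟩⟩,
    -- The bound of one half is exact for every `k ≥ 1`, so `k₀ = 1` and `C = 0` serve for all `ε`.
    fun ε hε => ⟨1, 0, fun P Q _ _ _ _ E k hk _ H hH => ?_⟩⟩
  refine le_trans ?_ (half_le_expect_of_isBalanced E hk H fun f i => (hH f i).exists_isBalanced)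
  have : (0 : ℝ) ≤ maxMatchingSize E := Nat.cast_nonneg _
  nlinarith
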